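/- Let $\log$ denote the natural logarithm and, for integers $N$ with $\log N\ge 983$, put $$\varepsilon(N)=\frac{\log\log\log N}{\log\log N}.$$ Then $$1<\left|e^{3}-\frac{M}{N}\right|\cdot 1561\cdot N^{\,2+\log 3\,(1+4\varepsilon(N))/\log\log N}\left(\frac{\log N}{\log\log N}\right)^{3}$$ for all integers $M\neq 0$ and all integers $N\ge 1$ with $\log N\ge 983$. -/

import Mathlib

/-- The function `ε(N) = log log log N / log log N` (natural logarithms). -/
noncomputable def eps (N : ℝ) : ℝ :=
  Real.log (Real.log (Real.log N)) / Real.log (Real.log N)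

/-! Hermite's integral of `exp (3 - x) * (x * (x - 3)) ^ n` yields integers q, p (the diagonal Padé
values at 3) with q e³ - p of sign (-1)^n and at most (9/4)^n e³/n!, while q is at most e³ (2n)!/n!.
Legendre's formula shows that q and p share a power of 3 of size about √3^n, which is divided out.

Let n be the least index with 2N times the remainder bound at most 1. Alternation of signs prevents
Mq - Np from vanishing at both n and n + 1. Where it is nonzero, it is an integer of absolute value
at least 1, so 1 ≤ 2N |e³ - M/N| A, with A the denominator bound at n + 1
(`one_le_abs_exp_three_sub`). With m = n - 1, minimality gives 1 < 2N · `remainderBound m`.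
Multiplying cancels the factorials and leaves N² · 3^m times a polynomial in m
(`denominatorBound_mul_remainderBound_le`). Finally m ≤ (log N / log log N)(1 + 3ε), and passing
from 3ε to 4ε absorbs the excess polynomial factor. -/

/-! ### Padé approximants from Hermite's integral -/

open Polynomial in
theorem hasDerivAt_exp_mul_sumIDeriv (f : ℝ[X]) (a x : ℝ) :
    HasDerivAt (fun t : ℝ => -(Real.exp (a - t) * f.sumIDeriv.eval t))
      (Real.exp (a - x) * f.eval x) x := by
  have h₁ : HasDerivAt (fun t : ℝ => Real.exp (a - t)) (-Real.exp (a - x)) x := by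
    simpa using ((hasDerivAt_id' x).const_sub a).exp
  have h := (h₁.mul (f.sumIDeriv.hasDerivAt x)).fun_neg
  refine h.congr_deriv ?_
  -- With F = `f.sumIDeriv`, F = f + F', so everything but f cancels.
  nth_rw 1 [sumIDeriv_eq_self_add f]
  simp only [eval_add]
  ring

open Polynomial in
theorem integral_exp_sub_mul_eval (f : ℝ[X]) (a : ℝ) :
    ∫ x in (0 : ℝ)..a, Real.exp (a - x) * f.eval x =
      Real.exp a * f.sumIDeriv.eval 0 - f.sumIDeriv.eval a := by
  rw [intervalIntegral.integral_eq_sub_of_hasDerivAt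
      (fun x _ => hasDerivAt_exp_mul_sumIDeriv f a x)
      (ContinuousOn.intervalIntegrable (by fun_prop))]
  simp
  ring

/-- The sum `∑ k ≤ n, (n + k)! / n! * (n choose k) * c ^ (n - k)`; up to a factor, the diagonal
Padé numerator and denominator of the exponential function at `a` are its values at
`c = a` and `c = -a`. -/
def padeSum (n : ℕ) (c : ℤ) : ℤ :=
  ∑ k ∈ Finset.range (n + 1), ((n + 1).ascFactorial k : ℤ) * (n.choose k : ℤ) * c ^ (n - k)

-- The j-th derivative at r is j! times the j-th Taylor coefficient; these vanish for j < n, and j =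
-- n + k gives the k-th term of `padeSum`.
open Polynomial in
theorem eval_sumIDeriv_of_taylor_eq (n : ℕ) (f : ℝ[X]) (r : ℝ) (c : ℤ)
    (h : taylor r f = X ^ n * (X + C (c : ℝ)) ^ n) :
    f.sumIDeriv.eval r = (n.factorial : ℝ) * padeSum n c := by
  have hdeg : f.natDegree ≤ 2 * n := by
    rw [← natDegree_taylor f r, h]
    compute_degree
    omega
  have hev : ∀ j, (derivative^[j] f).eval r = (j.factorial : ℝ) * (taylor r f).coeff j := by
    intro j
    rw [taylor_coeff, ← factorial_smul_hasseDeriv]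
    simp
  rw [sumIDeriv_apply_of_le hdeg, eval_finsetSum]
  simp only [hev, h]
  rw [show 2 * n + 1 = n + (n + 1) by ring, Finset.sum_range_add]
  rw [Finset.sum_eq_zero, zero_add, padeSum]
  · push_cast
    rw [Finset.mul_sum]
    refine Finset.sum_congr rfl fun k _ => ?_
    rw [add_comm n k, coeff_X_pow_mul, coeff_X_add_C_pow, add_comm k n,
      ← Nat.factorial_mul_ascFactorial]
    push_cast
    ring
  · intro i hi
    rw [coeff_X_pow_mul', if_neg (by simpa using hi), mul_zero]

open Polynomial in
/-- The Padé remainder at `3` as an integral. -/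
theorem factorial_mul_padeSum_sub (n : ℕ) :
    (n.factorial : ℝ) * (padeSum n (-3) * Real.exp 3 - padeSum n 3) =
      ∫ x in (0 : ℝ)..3, Real.exp (3 - x) * (x * (x - 3)) ^ n := by
  have h := integral_exp_sub_mul_eval (X ^ n * (X - C (3 : ℝ)) ^ n) 3
  rw [eval_sumIDeriv_of_taylor_eq n _ 0 (-3) (by simp [sub_eq_add_neg]),
    eval_sumIDeriv_of_taylor_eq n _ 3 3 (by
      simp only [taylor_mul, taylor_pow, map_sub, taylor_X, taylor_C]
      push_cast
      ring)] at h
  simp only [eval_mul, eval_pow, eval_X, eval_sub, eval_C, ← mul_pow] at h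
  rw [h]
  ring

theorem integral_exp_three_sub : ∫ x in (0 : ℝ)..3, Real.exp (3 - x) = Real.exp 3 - 1 := by
  rw [intervalIntegral.integral_comp_sub_left (fun x => Real.exp x)]
  simp

/-- The Padé remainder at `3` alternates in sign and is small. -/
theorem neg_one_pow_mul_padeRemainder (n : ℕ) :
    0 < (-1) ^ n * ((padeSum n (-3) : ℝ) * Real.exp 3 - padeSum n 3) ∧
    (-1) ^ n * ((padeSum n (-3) : ℝ) * Real.exp 3 - padeSum n 3) ≤
      (9 / 4) ^ n * Real.exp 3 / n.factorial := by
  have hf : (0 : ℝ) < n.factorial := by positivity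
  have h : (n.factorial : ℝ) * ((-1) ^ n * (padeSum n (-3) * Real.exp 3 - padeSum n 3)) =
      ∫ x in (0 : ℝ)..3, Real.exp (3 - x) * (x * (3 - x)) ^ n := by
    rw [mul_left_comm, factorial_mul_padeSum_sub, ← intervalIntegral.integral_const_mul]
    congr 1
    ext x
    rw [mul_left_comm, ← mul_pow]
    ring
  constructor
  · refine pos_of_mul_pos_right (a := (n.factorial : ℝ)) ?_ hf.le
    rw [h]
    refine intervalIntegral.intervalIntegral_pos_of_pos_on
      (Continuous.intervalIntegrable (by fun_prop) _ _) ?_ (by norm_num)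
    rintro x ⟨h0, h3⟩
    have : 0 < 3 - x := by linarith
    positivity
  · rw [le_div_iff₀' hf, h]
    calc _ ≤ ∫ x in (0 : ℝ)..3, Real.exp (3 - x) * (9 / 4) ^ n := by
          refine intervalIntegral.integral_mono_on (by norm_num)
            (Continuous.intervalIntegrable (by fun_prop) _ _)
            (Continuous.intervalIntegrable (by fun_prop) _ _) ?_
          rintro x ⟨h0, h3⟩
          have : 0 ≤ x * (3 - x) := mul_nonneg h0 (by linarith)
          gcongr
          nlinarith [sq_nonneg (x - 3 / 2)]
      _ = (Real.exp 3 - 1) * (9 / 4) ^ n := by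
          rw [intervalIntegral.integral_mul_const, integral_exp_three_sub]
      _ ≤ _ := by
          rw [mul_comm]
          gcongr
          linarith

/-! ### Size and positivity of the Padé values -/

theorem padeSum_le (n : ℕ) (c : ℤ) (a : ℝ) (hc : |(c : ℝ)| ≤ a) :
    |(padeSum n c : ℝ)| ≤ (n + 1).ascFactorial n * Real.exp a := by
  have ha : 0 ≤ a := (abs_nonneg _).trans hc
  calc |(padeSum n c : ℝ)|
      ≤ ∑ k ∈ Finset.range (n + 1),
          ((n + 1).ascFactorial k : ℝ) * (n.choose k : ℝ) * a ^ (n - k) := by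
        rw [padeSum]
        push_cast
        refine (Finset.abs_sum_le_sum_abs _ _).trans (Finset.sum_le_sum fun k _ => ?_)
        rw [abs_mul, abs_mul, abs_pow, Nat.abs_cast, Nat.abs_cast]
        gcongr
    _ ≤ ∑ k ∈ Finset.range (n + 1),
          ((n + 1).ascFactorial n : ℝ) * (a ^ (n - k) / (n - k).factorial) := by
        refine Finset.sum_le_sum fun k hk => ?_
        obtain ⟨i, rfl⟩ : ∃ i, n = k + i := ⟨n - k, by simp at hk; omega⟩
        rw [Nat.add_sub_cancel_left]
        have h1 : ((k + i).choose k : ℝ) ≤ (k + i : ℕ) ^ i / i.factorial := by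
          rw [Nat.choose_symm_add]
          exact Nat.choose_le_pow_div _ _
        -- The i factors missing from the shorter rising product each exceed n = k + i.
        have h2 : (((k + i + 1).ascFactorial k * (k + i) ^ i : ℕ) : ℝ) ≤
            ((k + i + 1).ascFactorial (k + i) : ℕ) := by
          norm_cast
          rw [← Nat.ascFactorial_mul_ascFactorial]
          gcongr
          refine le_trans ?_ (Nat.pow_succ_le_ascFactorial _ _)
          exact Nat.pow_le_pow_left (by omega) _
        push_cast at h1 h2
        calc _ ≤ ((k + i + 1).ascFactorial k : ℝ) * ((k + i) ^ i / i.factorial) * a ^ i := by gcongr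
          _ = ((k + i + 1).ascFactorial k * (k + i) ^ i) * (a ^ i / i.factorial) := by ring
          _ ≤ _ := by gcongr
    _ = ((n + 1).ascFactorial n : ℝ) * ∑ k ∈ Finset.range (n + 1), a ^ k / k.factorial := by
        rw [← Finset.mul_sum, ← Finset.sum_range_reflect (fun k => a ^ k / (k.factorial : ℝ))]
        simp
    _ ≤ _ := by
        gcongr
        exact Real.sum_le_exp_of_nonneg ha _

theorem ascFactorial_le_padeSum (n : ℕ) (c : ℤ) (hc : 0 ≤ c) :
    ((n + 1).ascFactorial n : ℤ) ≤ padeSum n c := by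
  rw [padeSum, Finset.sum_range_succ]
  simp only [Nat.choose_self, tsub_self, pow_zero, mul_one, Nat.cast_one]
  have : 0 ≤ ∑ k ∈ Finset.range n,
      ((n + 1).ascFactorial k : ℤ) * (n.choose k : ℤ) * c ^ (n - k) :=
    Finset.sum_nonneg fun k _ => by positivity
  linarith

theorem exp_three_lt : Real.exp 3 < 20.1 := by
  have := Real.exp_one_lt_d9
  rw [show (3 : ℝ) = ((3 : ℕ) : ℝ) * 1 by norm_num, Real.exp_nat_mul]
  calc Real.exp 1 ^ 3 < 2.7182818286 ^ 3 := by gcongr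
    _ < _ := by norm_num

/-- The terms alternate in sign, so positivity is read off from q e³ = p + remainder, where p ≥ 5^n
dominates. -/
theorem padeSum_neg_three_pos (n : ℕ) (hn : 5 ≤ n) : 0 < padeSum n (-3) := by
  have hR := (neg_one_pow_mul_padeRemainder n)
  have habs : |(padeSum n (-3) : ℝ) * Real.exp 3 - padeSum n 3| ≤
      (9 / 4) ^ n * Real.exp 3 / n.factorial := by
    have : |(padeSum n (-3) : ℝ) * Real.exp 3 - padeSum n 3| =
        |(-1) ^ n * ((padeSum n (-3) : ℝ) * Real.exp 3 - padeSum n 3)| := by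
      rw [abs_mul]; simp
    rw [this, abs_of_pos hR.1]
    exact hR.2
  have h1 : ((5 : ℝ)) ^ n ≤ padeSum n 3 := by
    have h2 := ascFactorial_le_padeSum n 3 (by norm_num)
    have h3 : 5 ^ n ≤ (n + 1).ascFactorial n :=
      le_trans (Nat.pow_le_pow_left (by omega) n) (Nat.pow_succ_le_ascFactorial _ _)
    have h4 : (5 : ℤ) ^ n ≤ padeSum n 3 := le_trans (by exact_mod_cast h3) h2
    exact_mod_cast h4
  have h5 : (9 / 4 : ℝ) ^ n * Real.exp 3 / n.factorial < 5 ^ n := by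
    have hf : (1 : ℝ) ≤ n.factorial := by exact_mod_cast Nat.factorial_pos n
    calc (9 / 4 : ℝ) ^ n * Real.exp 3 / n.factorial ≤ (9 / 4 : ℝ) ^ n * Real.exp 3 :=
          div_le_self (by positivity) hf
      _ < (9 / 4 : ℝ) ^ n * (20 / 9) ^ n := by
          gcongr
          calc Real.exp 3 < (20 / 9) ^ 5 := exp_three_lt.trans (by norm_num)
            _ ≤ _ := pow_le_pow_right₀ (by norm_num) hn
      _ = 5 ^ n := by rw [← mul_pow]; norm_num
  have h6 := abs_le.1 habs
  have h7 : 0 < (padeSum n (-3) : ℝ) * Real.exp 3 := by linarith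
  exact_mod_cast pos_of_mul_pos_left h7 (Real.exp_pos 3).le

/-! ### Common powers of 3 -/

/-- Lower bound for the exponent of `3` in all the terms of `padeSum n (±3)`. -/
theorem three_pow_dvd_ascFactorial_mul (n k : ℕ) (hk : k ≤ n) (hn : 0 < n) :
    3 ^ ((n + 1) / 2 - (Nat.log 3 (2 * n) + 1)) ∣ (n + 1).ascFactorial k * 3 ^ (n - k) := by
  have := Fact.mk Nat.prime_three
  have hA : (n + 1).ascFactorial k ≠ 0 := (Nat.ascFactorial_pos _ _).ne'
  rw [padicValNat_dvd_iff_le (mul_ne_zero hA (by positivity)),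
    padicValNat.mul hA (by positivity), padicValNat.prime_pow]
  have h1 := sub_one_mul_padicValNat_factorial (p := 3) n
  have h2 := sub_one_mul_padicValNat_factorial (p := 3) (n + k)
  rw [← Nat.factorial_mul_ascFactorial, padicValNat.mul (Nat.factorial_ne_zero _) hA] at h2
  -- By Legendre, the valuation is at least k/2 minus half this digit sum; adding n - k, the worst
  -- case is k = n.
  have h3 : (Nat.digits 3 (n + k)).sum ≤ (Nat.digits 3 (n + k)).length * 2 := by
    refine (List.sum_le_card_nsmul _ 2 fun d hd => ?_).trans (by simp)
    have := Nat.digits_lt_base (by norm_num : 1 < 3) hd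
    omega
  rw [Nat.length_digits 3 _ (by norm_num) (by omega)] at h3
  have h4 : Nat.log 3 (n + k) ≤ Nat.log 3 (2 * n) := Nat.log_mono_right (by omega)
  omega

theorem three_pow_dvd_padeSum (n : ℕ) (hn : 0 < n) (c : ℤ) (hc : 3 ∣ c) :
    (3 : ℤ) ^ ((n + 1) / 2 - (Nat.log 3 (2 * n) + 1)) ∣ padeSum n c := by
  refine Finset.dvd_sum fun k hk => ?_
  have h := three_pow_dvd_ascFactorial_mul n k (by simp at hk; omega) hn
  have h' : (3 : ℤ) ^ ((n + 1) / 2 - (Nat.log 3 (2 * n) + 1)) ∣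
      ((n + 1).ascFactorial k : ℤ) * 3 ^ (n - k) := by exact_mod_cast h
  rw [mul_right_comm]
  exact dvd_mul_of_dvd_left (h'.trans (mul_dvd_mul_left _ (pow_dvd_pow_of_dvd hc _))) _

theorem sqrt_three_pow_le (n : ℕ) (hn : 0 < n) :
    √3 ^ n ≤ (3 : ℝ) ^ ((n + 1) / 2 - (Nat.log 3 (2 * n) + 1)) * (6 * n) := by
  have h1 : (1 : ℝ) ≤ √3 := Real.one_le_sqrt.2 (by norm_num)
  have h2 : ((3 ^ Nat.log 3 (2 * n) : ℕ) : ℝ) ≤ (2 * n : ℕ) := by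
    exact_mod_cast Nat.pow_log_le_self 3 (by omega)
  push_cast at h2
  calc √3 ^ n ≤ √3 ^ (2 * ((n + 1) / 2)) := pow_le_pow_right₀ h1 (by omega)
    _ = 3 ^ ((n + 1) / 2) := by rw [pow_mul, Real.sq_sqrt (by norm_num)]
    -- Only an inequality, since the subtraction may truncate to 0.
    _ ≤ 3 ^ ((n + 1) / 2 - (Nat.log 3 (2 * n) + 1) + (Nat.log 3 (2 * n) + 1)) :=
        pow_le_pow_right₀ (by norm_num) (by omega)
    _ = 3 ^ ((n + 1) / 2 - (Nat.log 3 (2 * n) + 1)) * (3 * 3 ^ Nat.log 3 (2 * n)) := by ring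
    _ ≤ _ := mul_le_mul_of_nonneg_left (by linarith) (by positivity)

/-- Rational approximations to `e ^ 3`, after removal of the common powers of `3`. -/
theorem exists_approx_exp_three (n : ℕ) (hn : 5 ≤ n) :
    ∃ q p : ℤ, 0 < q ∧ 0 < (-1) ^ n * ((q : ℝ) * Real.exp 3 - p) ∧
      (-1) ^ n * ((q : ℝ) * Real.exp 3 - p) ≤
        (9 / 4) ^ n * Real.exp 3 / n.factorial * (6 * n / √3 ^ n) ∧
      (q : ℝ) ≤ (n + 1).ascFactorial n * Real.exp 3 * (6 * n / √3 ^ n) := by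
  obtain ⟨hR0, hR⟩ := neg_one_pow_mul_padeRemainder n
  have hq := padeSum_neg_three_pos n hn
  have hqle : (padeSum n (-3) : ℝ) ≤ (n + 1).ascFactorial n * Real.exp 3 :=
    (le_abs_self _).trans (padeSum_le n (-3) 3 (by norm_num))
  have hs := sqrt_three_pow_le n (by omega)
  obtain ⟨q, hq'⟩ := three_pow_dvd_padeSum n (by omega) (-3) (by norm_num)
  obtain ⟨p, hp'⟩ := three_pow_dvd_padeSum n (by omega) 3 (by norm_num)
  rw [hq'] at hq hqle hR0 hR
  rw [hp'] at hR0 hR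
  push_cast at hqle hR0 hR
  set D : ℝ := 3 ^ ((n + 1) / 2 - (Nat.log 3 (2 * n) + 1))
  have hD : 0 < D := by positivity
  have hDi : 1 ≤ D * (6 * n / √3 ^ n) := by
    rw [← mul_div_assoc, one_le_div (by positivity)]
    exact hs
  have key : ∀ x y : ℝ, 0 ≤ y → D * x ≤ y → x ≤ y * (6 * n / √3 ^ n) := by
    intro x y hy h
    have h1 : x ≤ y / D := by rwa [le_div_iff₀' hD]
    refine h1.trans ?_
    rw [div_le_iff₀ hD]
    nlinarith
  have e : (-1 : ℝ) ^ n * (D * q * Real.exp 3 - D * p) =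
      D * ((-1) ^ n * (q * Real.exp 3 - p)) := by ring
  rw [e] at hR0 hR
  refine ⟨q, p, pos_of_mul_pos_right hq (by positivity), pos_of_mul_pos_right hR0 hD.le,
    key _ _ (by positivity) hR, key _ _ (by positivity) ?_⟩
  exact hqle

/-! ### Nonvanishing and the product of the two bounds -/

/-- Bound for the normalised Padé remainder at `3`. -/
noncomputable def remainderBound (n : ℕ) : ℝ :=
  (9 / 4) ^ n * Real.exp 3 / n.factorial * (6 * n / √3 ^ n)

/-- Bound for the normalised Padé denominator at `3`. -/
noncomputable def denominatorBound (n : ℕ) : ℝ :=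
  (n + 1).ascFactorial n * Real.exp 3 * (6 * n / √3 ^ n)

theorem sqrt_three_le : √3 ≤ 2 := (Real.sqrt_le_left (by norm_num)).2 (by norm_num)

theorem remainderBound_nonneg (n : ℕ) : 0 ≤ remainderBound n := by
  rw [remainderBound]
  positivity

theorem remainderBound_succ_le (n : ℕ) (hn : 5 ≤ n) :
    remainderBound (n + 1) ≤ remainderBound n := by
  have h1 : (1 : ℝ) ≤ √3 := Real.one_le_sqrt.2 (by norm_num)
  have hn' : (5 : ℝ) ≤ n := by exact_mod_cast hn
  have e : remainderBound (n + 1) = remainderBound n * (9 / 4 / (n * √3)) := by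
    rw [remainderBound, remainderBound, Nat.factorial_succ, pow_succ, pow_succ]
    push_cast
    field_simp
  rw [e]
  refine mul_le_of_le_one_right (remainderBound_nonneg n) ?_
  rw [div_le_one (by positivity)]
  nlinarith

theorem denominatorBound_le_succ (n : ℕ) :
    denominatorBound n ≤ denominatorBound (n + 1) := by
  have h1 : √3 ≤ 2 := sqrt_three_le
  have h0 : 0 < √3 := by positivity
  have h2 : ((n + 1).ascFactorial n : ℝ) * 2 ≤ (n + 1 + 1).ascFactorial (n + 1) := by
    norm_cast
    rw [Nat.ascFactorial_succ, mul_comm]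
    exact Nat.mul_le_mul (by omega) (Nat.ascFactorial_le n (by omega))
  rw [denominatorBound, denominatorBound, pow_succ]
  calc _ = ((n + 1).ascFactorial n * √3) * Real.exp 3 * (6 * n / (√3 ^ n * √3)) := by
        field_simp
    _ ≤ ((n + 1).ascFactorial n * 2) * Real.exp 3 * (6 * n / (√3 ^ n * √3)) := by gcongr
    _ ≤ _ := by gcongr; simp

theorem one_le_two_mul_of_ne (M N : ℤ) (hN : 0 < N) (q p : ℤ) (a B A : ℝ) (hq : 0 < q)
    (hne : M * q - N * p ≠ 0) (hB : |(q : ℝ) * a - p| ≤ B) (hA : (q : ℝ) ≤ A)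
    (hNB : 2 * N * B ≤ 1) : 1 ≤ 2 * N * |a - M / N| * A := by
  have hN' : (0 : ℝ) < N := by exact_mod_cast hN
  have hq' : (0 : ℝ) < q := by exact_mod_cast hq
  have h1 : (1 : ℝ) ≤ |(M : ℝ) * q - N * p| := by exact_mod_cast Int.one_le_abs hne
  have e : (M : ℝ) * q - N * p = N * (q * a - p) - N * q * (a - M / N) := by
    field_simp
    ring
  have h2 := abs_sub (N * (q * a - p)) (N * q * (a - M / N))
  rw [← e, abs_mul, abs_mul, abs_mul, abs_of_pos hN', abs_of_pos hq'] at h2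
  have h3 : (N : ℝ) * |(q : ℝ) * a - p| ≤ N * B := by gcongr
  have h4 : (N : ℝ) * q * |a - M / N| ≤ N * A * |a - M / N| := by gcongr
  linarith

theorem one_le_abs_exp_three_sub (M N : ℤ) (hN : 0 < N) (n : ℕ) (hn : 5 ≤ n)
    (hB : 2 * N * remainderBound n ≤ 1) :
    1 ≤ 2 * N * |Real.exp 3 - M / N| * denominatorBound (n + 1) := by
  have hN' : (0 : ℝ) < N := by exact_mod_cast hN
  have habs : ∀ (k : ℕ) (x : ℝ), 0 < (-1) ^ k * x → |x| = (-1) ^ k * x := by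
    intro k x h
    rw [← abs_of_pos h, abs_mul]
    simp
  obtain ⟨q, p, hq, hR0, hR, hQ⟩ := exists_approx_exp_three n hn
  obtain ⟨q', p', hq', hR0', hR', hQ'⟩ := exists_approx_exp_three (n + 1) (by omega)
  by_cases h : M * q - N * p = 0
  · refine one_le_two_mul_of_ne M N hN q' p' _ (remainderBound (n + 1)) _ hq' ?_
      ((habs _ _ hR0').trans_le hR') hQ' ?_
    · intro h'
      have h1 : (M : ℝ) * q - N * p = 0 := by exact_mod_cast h
      have h2 : (M : ℝ) * q' - N * p' = 0 := by exact_mod_cast h'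
      have hqr : (0 : ℝ) < q := by exact_mod_cast hq
      have hqr' : (0 : ℝ) < q' := by exact_mod_cast hq'
      -- If both forms vanished, both remainders would have the sign of N e³ - M, against
      -- alternation.
      have e1 : (N : ℝ) * ((-1) ^ n * (q * Real.exp 3 - p)) =
          q * ((-1) ^ n * (N * Real.exp 3 - M)) := by linear_combination (-1) ^ n * h1
      have e2 : (N : ℝ) * ((-1) ^ (n + 1) * (q' * Real.exp 3 - p')) =
          -(q' * ((-1) ^ n * (N * Real.exp 3 - M))) := by
        linear_combination (-1) ^ (n + 1) * h2
      have p1 := pos_of_mul_pos_right ((mul_pos hN' hR0).trans_eq e1) hqr.le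
      have p2 := (mul_pos hN' hR0').trans_eq e2
      have := mul_pos hqr' p1
      linarith
    · exact (mul_le_mul_of_nonneg_left (remainderBound_succ_le n hn) (by positivity)).trans hB
  · exact one_le_two_mul_of_ne M N hN q p _ (remainderBound n) _ hq h
      ((habs _ _ hR0).trans_le hR) (hQ.trans (denominatorBound_le_succ n)) hB

/-- The growth rate is 4 · (9/4) / 3 = 3, the source of log 3 in the exponent; 404.1 · 36 · 16 / 3 <
77600. -/
theorem denominatorBound_mul_remainderBound_le (m : ℕ) :
    denominatorBound (m + 2) * remainderBound m ≤ 77600 * (m + 2 : ℝ) ^ 4 * 3 ^ m := by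
  have hasc : ((m + 2 + 1).ascFactorial (m + 2) : ℝ) ≤
      (m + 2) * (m + 1) * m.factorial * 4 ^ (m + 2) := by
    have h1 := Nat.ascFactorial_eq_factorial_mul_choose (m + 2) (m + 2)
    have h2 : (m + 2 + (m + 2)).choose (m + 2) ≤ 4 ^ (m + 2) := by
      rw [← two_mul]
      calc _ ≤ 2 ^ (2 * (m + 2)) := Nat.choose_le_two_pow _ _
        _ = 4 ^ (m + 2) := by rw [pow_mul]; norm_num
    rw [h1, Nat.factorial_succ, Nat.factorial_succ]
    push_cast
    have h3 : (((m + 2 + (m + 2)).choose (m + 2) : ℕ) : ℝ) ≤ 4 ^ (m + 2) := by exact_mod_cast h2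
    calc _ ≤ (((m : ℝ) + 1 + 1) * ((m + 1) * m.factorial)) * 4 ^ (m + 2) := by gcongr
      _ = _ := by ring
  have he : Real.exp 3 ^ 2 ≤ 404.1 := by
    have := exp_three_lt
    nlinarith [Real.exp_pos 3]
  have hs : √3 ^ (m + 2) * √3 ^ m = 3 ^ (m + 1) := by
    rw [← pow_add, show m + 2 + m = 2 * (m + 1) by ring, pow_mul, Real.sq_sqrt (by norm_num)]
  rw [denominatorBound, remainderBound]
  push_cast
  calc _ = ((m + 2 + 1).ascFactorial (m + 2) : ℝ) * (Real.exp 3 ^ 2 * 36 * m * (m + 2) *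
        (9 / 4) ^ m / m.factorial / (√3 ^ (m + 2) * √3 ^ m)) := by
        field_simp
        ring
    _ ≤ ((m + 2) * (m + 1) * m.factorial * 4 ^ (m + 2)) * (404.1 * 36 * (m + 2) * (m + 2) *
        (9 / 4) ^ m / m.factorial / (√3 ^ (m + 2) * √3 ^ m)) := by
        gcongr
        linarith
    _ = 404.1 * 36 * 16 / 3 * ((m + 2) * (m + 1) * (m + 2) * (m + 2)) *
        (4 ^ m * (9 / 4) ^ m / 3 ^ m) := by
        rw [hs, pow_succ 3 m, pow_add 4 m 2]
        field_simp
        ring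
    _ = 404.1 * 36 * 16 / 3 * ((m + 2) * (m + 1) * (m + 2) * (m + 2)) * 3 ^ m := by
        rw [← mul_pow, ← div_pow]
        norm_num
    _ ≤ 77600 * ((m + 2) * (m + 2) * (m + 2) * (m + 2)) * 3 ^ m := by
        gcongr
        · norm_num
        · norm_num
    _ = _ := by ring

/-- Here 1.3 = 1 + 0.3, from m! ≥ (m/e)^m and (9/4)/√3 ≤ e^0.3; 6e³ ≤ e⁵ makes the constant 5 + 1.3
≤ 6.5. -/
theorem remainderBound_le (m : ℕ) (hm : 1 ≤ m) :
    remainderBound m ≤ Real.exp (6.5 - (m - 1) * (Real.log m - 1.3)) := by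
  have hm0 : (0 : ℝ) < m := by exact_mod_cast hm
  have h1 : (m : ℝ) ^ m / Real.exp m ≤ m.factorial := by
    have := Real.pow_div_factorial_le_exp (m : ℝ) hm0.le m
    rw [div_le_iff₀ (by positivity)] at this ⊢
    linarith
  have h2 : (9 / 4) / √3 ≤ Real.exp 0.3 := by
    have h3 : 1.7 ≤ √3 := Real.le_sqrt_of_sq_le (by norm_num)
    have h4 := Real.quadratic_le_exp_of_nonneg (x := 0.3) (by norm_num)
    rw [div_le_iff₀ (by positivity)]
    nlinarith
  have h6 : (6 : ℝ) ≤ Real.exp 2 := by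
    have := Real.exp_one_gt_d9
    rw [show (2 : ℝ) = 1 + 1 by norm_num, Real.exp_add]
    nlinarith
  have hmm : (m : ℝ) ^ m = Real.exp (m * Real.log m) := by
    rw [Real.exp_nat_mul, Real.exp_log hm0]
  rw [remainderBound]
  calc _ = ((9 / 4) / √3) ^ m * Real.exp 3 * 6 * m / m.factorial := by
        rw [div_pow _ √3]; ring
    _ ≤ Real.exp 0.3 ^ m * Real.exp 3 * Real.exp 2 * m / (m ^ m / Real.exp m) := by gcongr
    _ = Real.exp (m * 0.3) * Real.exp 3 * Real.exp 2 * Real.exp (Real.log m) /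
          (Real.exp (m * Real.log m) / Real.exp m) := by
        rw [hmm, Real.exp_log hm0, ← Real.exp_nat_mul]
    _ = Real.exp (m * 0.3 + 3 + 2 + Real.log m - (m * Real.log m - m)) := by
        simp only [Real.exp_add, Real.exp_sub]
    _ ≤ _ := by
        refine Real.exp_le_exp.2 ?_
        linarith

/-! ### Numerical estimates and the size of the index -/

theorem exp_seven_bounds : 1096 ≤ Real.exp 7 ∧ Real.exp 7 ≤ 1097 := by
  have h1 := Real.exp_one_gt_d9
  have h2 := Real.exp_one_lt_d9
  rw [show (7 : ℝ) = ((7 : ℕ) : ℝ) * 1 by norm_num, Real.exp_nat_mul]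
  constructor
  · calc (1096 : ℝ) ≤ 2.7182818283 ^ 7 := by norm_num
      _ ≤ _ := by gcongr
  · calc _ ≤ (2.7182818286 : ℝ) ^ 7 := by gcongr
      _ ≤ _ := by norm_num

theorem le_log_983 : 6.88 ≤ Real.log 983 := by
  rw [Real.le_log_iff_exp_le (by norm_num)]
  have h := Real.quadratic_le_exp_of_nonneg (x := 0.12) (by norm_num)
  have h7 := exp_seven_bounds.2
  rw [show (7 : ℝ) = 6.88 + 0.12 by norm_num, Real.exp_add] at h7
  nlinarith [Real.exp_pos 6.88]

theorem cube_le_exp (x : ℝ) (hx : 6.88 ≤ x) : 2.9 * x ^ 3 ≤ Real.exp x := by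
  have h0 : 960 ≤ Real.exp 6.88 := by
    have h := Real.add_one_le_exp (-0.12)
    rw [show (6.88 : ℝ) = 7 + (-0.12) by norm_num, Real.exp_add]
    nlinarith [exp_seven_bounds.1]
  have e : x / 6.88 = 25 / 172 * x := by
    rw [div_eq_iff (by norm_num)]
    ring
  have h1 : (x / 6.88) ^ 3 ≤ Real.exp (x - 6.88) := by
    calc (x / 6.88) ^ 3 ≤ Real.exp (x / 6.88 - 1) ^ 3 := by
          have := Real.add_one_le_exp (x / 6.88 - 1)
          gcongr
          linarith
      _ = Real.exp ((3 : ℕ) * (x / 6.88 - 1)) := by rw [Real.exp_nat_mul]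
      _ ≤ _ := by
          gcongr
          push_cast
          rw [e]
          linarith
  calc 2.9 * x ^ 3 ≤ 960 * (x / 6.88) ^ 3 := by
        rw [e, mul_pow]
        have : 0 ≤ x ^ 3 := by positivity
        linarith
    _ ≤ Real.exp 6.88 * Real.exp (x - 6.88) := by gcongr
    _ = Real.exp x := by rw [← Real.exp_add]; congr 1; ring

theorem le_log_of_le (x : ℝ) (hx : 6.88 ≤ x) : 1.9 ≤ Real.log x := by
  rw [Real.le_log_iff_exp_le (by linarith)]
  refine le_trans ?_ hx
  have h1 := Real.exp_one_lt_d9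
  have h2 := Real.add_one_le_exp (0.1 : ℝ)
  have h3 : Real.exp 1 * Real.exp 1 = Real.exp 1.9 * Real.exp 0.1 := by
    rw [← Real.exp_add, ← Real.exp_add]; norm_num
  nlinarith [Real.exp_pos 1.9, Real.exp_pos 1]

theorem log_le_mul (x : ℝ) (hx : 6.88 ≤ x) : Real.log x ≤ 0.29 * x := by
  have h0 : Real.log 6.88 ≤ 1.95 := by
    rw [Real.log_le_iff_le_exp (by norm_num)]
    have h1 := Real.exp_one_gt_d9
    have h2 := Real.add_one_le_exp (-0.05 : ℝ)
    rw [show (1.95 : ℝ) = 1 + 1 + (-0.05) by norm_num, Real.exp_add, Real.exp_add]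
    have : 7.38 ≤ Real.exp 1 * Real.exp 1 := by nlinarith
    nlinarith
  have e : x / 6.88 = 25 / 172 * x := by
    rw [div_eq_iff (by norm_num)]
    ring
  have h1 := Real.log_le_sub_one_of_pos (x := x / 6.88) (by positivity)
  rw [Real.log_div (by linarith) (by norm_num), e] at h1
  linarith

/-- The point `Y = (L / l) (1 + 3 log l / l)`, where `L = exp l`, is an upper bound for the
solution of `(m - 1) (log m - 1.3) = L + O(1)`. -/
theorem exp_add_le_mul_log (l Y : ℝ) (hl : 6.88 ≤ l)
    (hY : Y = Real.exp l / l * (1 + 3 * (Real.log l / l))) :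
    Real.exp l + 7.5 ≤ (Y - 1) * (Real.log Y - 1.3) ∧ 1 ≤ Y ∧ 1.3 ≤ Real.log Y := by
  have hl0 : 0 < l := by linarith
  have hy := le_log_of_le l hl
  have hyl := log_le_mul l hl
  have hL := cube_le_exp l hl
  set y := Real.log l with hydef
  set t := y / l with ht
  have hty : t * l = y := div_mul_cancel₀ _ hl0.ne'
  have ht0 : 0 < t := div_pos (by linarith) hl0
  have ht1 : t ≤ 0.29 := (div_le_iff₀ hl0).2 hyl
  set K := Real.exp l / l with hK
  have hK0 : 0 < K := by positivity
  have hKl : K * l = Real.exp l := div_mul_cancel₀ _ hl0.ne'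
  have hKge : 2.9 * l ^ 2 ≤ K := by
    rw [hK, le_div_iff₀ hl0]; linarith
  have h1t : 0 < 1 + 3 * t := by linarith
  have hlog : Real.log Y = l - y + Real.log (1 + 3 * t) := by
    rw [hY, Real.log_mul hK0.ne' h1t.ne', hK, Real.log_div (Real.exp_pos l).ne' hl0.ne',
      Real.log_exp]
  have hu : 3 * t ≤ (1 + 3 * t) * Real.log (1 + 3 * t) := by
    have := mul_le_mul_of_nonneg_left (Real.one_sub_inv_le_log_of_pos h1t) h1t.le
    rw [mul_sub, mul_inv_cancel₀ h1t.ne'] at this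
    linarith
  have hu0 : 0 ≤ Real.log (1 + 3 * t) := Real.log_nonneg (by linarith)
  have hu1 : Real.log (1 + 3 * t) ≤ 3 * t := by
    have := Real.log_le_sub_one_of_pos h1t
    linarith
  -- As tl = y, the coefficient 3 gains 3y against the loss y, enough for t ≤ 0.29 and y ≥ 1.9.
  have hbr : l + 0.5 ≤ (1 + 3 * t) * (l - y - 1.3) + 3 * t := by
    have : (1 + 3 * t) * (l - y - 1.3) + 3 * t = l + (y * (2 - 3 * t) - 1.3 - 0.9 * t) := by
      linear_combination 3 * hty
    rw [this]
    nlinarith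
  have hmain : Real.exp l + 0.5 * K ≤ Y * (Real.log Y - 1.3) := by
    calc Real.exp l + 0.5 * K = K * (l + 0.5) := by rw [← hKl]; ring
      _ ≤ K * ((1 + 3 * t) * (l - y - 1.3) + (1 + 3 * t) * Real.log (1 + 3 * t)) :=
          mul_le_mul_of_nonneg_left (by linarith) hK0.le
      _ = _ := by rw [hlog, hY]; ring
  have hlogY : Real.log Y ≤ l := by rw [hlog]; linarith
  have hYK : K ≤ Y := by rw [hY]; exact le_mul_of_one_le_right hK0.le (by linarith)
  refine ⟨?_, ?_, ?_⟩
  -- The surplus K/2 ≥ 1.45 l² covers 7.5 + log Y - 1.3 ≤ l + 6.2.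
  · nlinarith
  · nlinarith
  · rw [hlog]; linarith

/-- The margin 7.5 is spent here: 6.5 from `remainderBound_le`, 1 from 2 ≤ e. -/
theorem two_mul_exp_mul_remainderBound_le (l : ℝ) (hl : 6.88 ≤ l) (m : ℕ)
    (hm : Real.exp l / l * (1 + 3 * (Real.log l / l)) ≤ m) :
    2 * Real.exp (Real.exp l) * remainderBound m ≤ 1 := by
  obtain ⟨h1, h2, h3⟩ := exp_add_le_mul_log l _ hl rfl
  set Y := Real.exp l / l * (1 + 3 * (Real.log l / l))
  have hm1 : (1 : ℝ) ≤ m := h2.trans hm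
  have hlog : Real.log Y ≤ Real.log m := Real.log_le_log (by linarith) hm
  have h4 : (Y - 1) * (Real.log Y - 1.3) ≤ (m - 1) * (Real.log m - 1.3) :=
    mul_le_mul (by linarith) (by linarith) (by linarith) (by linarith)
  have h5 : (2 : ℝ) ≤ Real.exp 1 := by linarith [Real.exp_one_gt_d9]
  have h6 := remainderBound_nonneg m
  calc _ ≤ Real.exp 1 * Real.exp (Real.exp l) *
        Real.exp (6.5 - (m - 1) * (Real.log m - 1.3)) := by
        gcongr
        exact remainderBound_le m (by exact_mod_cast hm1)
    _ = Real.exp (1 + Real.exp l + (6.5 - (m - 1) * (Real.log m - 1.3))) := by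
        rw [Real.exp_add, Real.exp_add]
    _ ≤ 1 := Real.exp_le_one_iff.2 (by linarith)

/-- The spare factor 3^(Kt) exceeds 6576 K, reducing K⁴ to K³; then 4 · 77600 · 16 < 1561 · 6576. -/
theorem pow_four_mul_three_pow_lt (l : ℝ) (hl : 6.88 ≤ l) (m : ℕ)
    (hm : (m : ℝ) ≤ Real.exp l / l * (1 + 3 * (Real.log l / l))) :
    4 * (77600 * ((m : ℝ) + 2) ^ 4 * 3 ^ m) <
      1561 * (3 : ℝ) ^ (Real.exp l / l * (1 + 4 * (Real.log l / l))) *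
        (Real.exp l / l) ^ 3 := by
  have hl0 : 0 < l := by linarith
  have hy := le_log_of_le l hl
  have hyl := log_le_mul l hl
  have hL := cube_le_exp l hl
  set y := Real.log l with hydef
  set t := y / l with ht
  have ht0 : 0 < t := div_pos (by linarith) hl0
  have ht1 : t ≤ 0.29 := (div_le_iff₀ hl0).2 hyl
  set K := Real.exp l / l with hK
  have hK0 : 0 < K := by positivity
  have hKge : 2.9 * l ^ 2 ≤ K := by
    rw [hK, le_div_iff₀ hl0]; linarith
  have hKle : 6 * K ≤ Real.exp l := by
    have : K * l = Real.exp l := div_mul_cancel₀ _ hl0.ne'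
    nlinarith
  have hm2 : (m : ℝ) + 2 ≤ 2 * K := by nlinarith
  have hKt : l + 7 ≤ K * t := by
    have h1 : 2.9 * l * y ≤ K * t := by
      calc 2.9 * l * y = 2.9 * l ^ 2 * t := by rw [ht]; field_simp
        _ ≤ _ := by gcongr
    nlinarith
  have h3 : 6576 * K ≤ (3 : ℝ) ^ (K * t) := by
    calc 6576 * K = 1096 * (6 * K) := by ring
      _ ≤ Real.exp 7 * Real.exp l := by gcongr; exact exp_seven_bounds.1
      _ = Real.exp (l + 7) := by rw [← Real.exp_add, add_comm]
      _ ≤ Real.exp (K * t) := Real.exp_le_exp.2 hKt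
      _ = Real.exp 1 ^ (K * t) := by rw [Real.exp_one_rpow]
      _ ≤ 3 ^ (K * t) := by
          gcongr
          linarith [Real.exp_one_lt_d9]
  have hmY : (3 : ℝ) ^ m ≤ (3 : ℝ) ^ (K * (1 + 3 * t)) := by
    rw [← Real.rpow_natCast]
    exact Real.rpow_le_rpow_of_exponent_le (by norm_num) hm
  have hX : (3 : ℝ) ^ (K * (1 + 4 * t)) = (3 : ℝ) ^ (K * (1 + 3 * t)) * (3 : ℝ) ^ (K * t) := by
    rw [← Real.rpow_add (by norm_num)]
    congr 1
    ring
  rw [hX]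
  have hP : (0 : ℝ) < 3 ^ (K * (1 + 3 * t)) := by positivity
  calc _ ≤ 4 * (77600 * (2 * K) ^ 4 * (3 : ℝ) ^ (K * (1 + 3 * t))) := by gcongr
    _ < 1561 * ((3 : ℝ) ^ (K * (1 + 3 * t)) * (6576 * K)) * K ^ 3 := by
        have : 0 < K ^ 4 * (3 : ℝ) ^ (K * (1 + 3 * t)) := by positivity
        nlinarith
    _ ≤ _ := by gcongr

/-! ### Choice of the index and conclusion -/

/-- Excludes n = 5 as the least index, so that n - 1 ≥ 5 and minimality applies to it. -/
theorem one_lt_two_mul_remainderBound_five (x : ℝ) (hx : 10 ≤ x) :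
    1 < 2 * x * remainderBound 5 := by
  have hs : √3 ^ 5 ≤ 32 := by
    calc √3 ^ 5 ≤ 2 ^ 5 := by gcongr; exact sqrt_three_le
      _ = 32 := by norm_num
  have h : (9 / 4 : ℝ) ^ 5 * 1 / 120 * (30 / 32) ≤ remainderBound 5 := by
    rw [remainderBound]
    have h1 : (1 : ℝ) ≤ Real.exp 3 := Real.one_le_exp (by norm_num)
    have h2 : ((Nat.factorial 5 : ℕ) : ℝ) = 120 := by norm_num [Nat.factorial]
    rw [h2]
    push_cast
    gcongr
    norm_num
  nlinarith

theorem corollary4 (M N : ℤ) (hM : M ≠ 0) (hN : 1 ≤ N) (hlogN : 983 ≤ Real.log (N : ℝ)) :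
    1 < |Real.exp 3 - (M : ℝ) / (N : ℝ)| * 1561 *
      (N : ℝ) ^ (2 + Real.log 3 * (1 + 4 * eps (N : ℝ)) / Real.log (Real.log (N : ℝ))) *
      (Real.log (N : ℝ) / Real.log (Real.log (N : ℝ))) ^ (3 : ℕ) := by
  have hN0 : (0 : ℝ) < N := by exact_mod_cast hN
  rw [eps]
  obtain ⟨l, hl⟩ : ∃ l, l = Real.log (Real.log N) := ⟨_, rfl⟩
  have hL : Real.log N = Real.exp l := by rw [hl, Real.exp_log (by linarith)]
  have hNe : (N : ℝ) = Real.exp (Real.exp l) := by rw [← hL, Real.exp_log hN0]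
  have hl6 : 6.88 ≤ l := by
    rw [hl]
    exact le_log_983.trans (Real.log_le_log (by norm_num) hlogN)
  have hN10 : (10 : ℝ) ≤ N := by linarith [Real.log_le_sub_one_of_pos hN0]
  have hpow : (N : ℝ) ^ (2 + Real.log 3 * (1 + 4 * (Real.log l / l)) / l) =
      (N : ℝ) ^ 2 * (3 : ℝ) ^ (Real.exp l / l * (1 + 4 * (Real.log l / l))) := by
    rw [Real.rpow_add hN0, Real.rpow_ofNat, Real.rpow_def_of_pos hN0, hL,
      Real.rpow_def_of_pos (by norm_num : (0 : ℝ) < 3)]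
    congr 2
    ring
  have hex : ∃ n : ℕ, 5 ≤ n ∧ 2 * (N : ℝ) * remainderBound n ≤ 1 := by
    refine ⟨max 5 ⌈Real.exp l / l * (1 + 3 * (Real.log l / l))⌉₊, le_max_left _ _, ?_⟩
    rw [hNe]
    refine two_mul_exp_mul_remainderBound_le l hl6 _ ((Nat.le_ceil _).trans ?_)
    exact_mod_cast le_max_right _ _
  classical
  obtain ⟨hn5, hnB⟩ := Nat.find_spec hex
  have hmin := fun k => Nat.find_min hex (m := k)
  set n := Nat.find hex
  have hn : n ≠ 5 := by
    intro h
    rw [h] at hnB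
    linarith [one_lt_two_mul_remainderBound_five N hN10]
  obtain ⟨m, hm⟩ : ∃ m, n = m + 1 := ⟨n - 1, by omega⟩
  have hmB : 1 < 2 * (N : ℝ) * remainderBound m := by
    by_contra hcon
    exact hmin m (by omega) ⟨by omega, not_lt.1 hcon⟩
  have hmY : (m : ℝ) ≤ Real.exp l / l * (1 + 3 * (Real.log l / l)) := by
    by_contra hcon
    have := two_mul_exp_mul_remainderBound_le l hl6 m (not_le.1 hcon).le
    rw [← hNe] at this
    linarith
  have h1 := one_le_abs_exp_three_sub M N (by omega) n hn5 hnB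
  rw [hm] at h1
  have hlt := pow_four_mul_three_pow_lt l hl6 m hmY
  have hDB := denominatorBound_mul_remainderBound_le m
  rw [← hl, hL, hpow]
  set δ := |Real.exp 3 - (M : ℝ) / N|
  have hδ : 0 < δ := by
    refine (abs_nonneg _).lt_of_ne fun h => ?_
    rw [show δ = 0 from h.symm] at h1
    norm_num at h1
  calc (1 : ℝ) < (2 * N * remainderBound m) := hmB
    _ ≤ (2 * N * δ * denominatorBound (m + 1 + 1)) * (2 * N * remainderBound m) :=
        le_mul_of_one_le_left (by linarith) h1
    _ = δ * (N : ℝ) ^ 2 * (4 * (denominatorBound (m + 2) * remainderBound m)) := by ring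
    _ ≤ δ * (N : ℝ) ^ 2 * (4 * (77600 * ((m : ℝ) + 2) ^ 4 * 3 ^ m)) := by gcongr
    _ ≤ δ * (N : ℝ) ^ 2 * (1561 * (3 : ℝ) ^ (Real.exp l / l * (1 + 4 * (Real.log l / l))) *
        (Real.exp l / l) ^ 3) := by gcongr
    _ = _ := by ring
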